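/- **Setting.** Let $\mathcal W,\mathcal X,\hat{\mathcal W}$ be measurable spaces, $P_W$ a probability measure (prior) on $\mathcal W$, $P_{X|W}$ a Markov kernel from $\mathcal W$ to $\mathcal X$, and $\ell:\mathcal W\times\hat{\mathcal W}\to[0,\infty)$ a measurable loss. The Bayesian risk is $R_B=\inf_\phi \mathbb E[\ell(W,\phi(X))]$, where $W\sim P_W$, $X\sim P_{X|W}$, and the infimum is over all measurable $\phi:\mathcal X\to\hat{\mathcal W}$. Let $\mathcal U$ be a measurable space, $P_{U|W,X}$ a Markov kernel from $\mathcal W\times\mathcal X$ to $\mathcal U$, $P_{WXU}$ the resulting joint law of $(W,X,U)$, $P_U$ the law of $U$, and $P_{W|U}$ a regular conditional distribution of $W$ given $U$ (a Markov kernel, assumed to exist). **Definitions.** - For probability measures $P,Q$ with densities $p,q$ with respect to a common dominating measure $m$, $D_\alpha(P\|Q)=\frac1{\alpha-1}\log\int p^\alpha q^{1-\alpha}\,dm$ for $\alpha>1$ (so $D_\alpha=\infty$ if $P\not\ll Q$), and $D_1$ is the Kullback–Leibler divergence. - $I_\alpha(W,X|U)=\inf_{Q_{X|U}} D_\alpha\big(P_{WXU}\,\big\|\,P_U\,P_{W|U}\,Q_{X|U}\big)$,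 the infimum being over all Markov kernels $Q_{X|U}$ from $\mathcal U$ to $\mathcal X$. - $L_{W|U}(u,\rho)=\sup_{\hat w\in\hat{\mathcal W}}P_{W|U=u}(\ell(W,\hat w)<\rho)$, assumed to be a $P_U$-almost everywhere measurable function of $u$, so that $\mathbb E_U[L_{W|U}(U,\rho)]$ is defined. - $\mathcal L(W\to X|U)=\sup_T\log\dfrac{\sup_{\hat t}\mathbb P(T=\hat t(X,U))}{\sup_{\tilde t}\mathbb P(T=\tilde t(U))}$, the conditional maximal leakage, where $T$ runs over all random variables with values in an arbitrary finite alphabet such that $T-W-X$ is a Markov chain conditionally on $U$, and $\hat t,\tilde t$ run over all measurable estimators. **Theorem.** For every such $U$ with kernel $P_{U|W,X}$, every $\rho>0$ and every real $\alpha\ge1$, $$R_B\ \ge\ \rho\left(1-\exp\left(\frac{\alpha-1}{\alpha}\Big(I_\alpha(W,X|U)+\log\mathbb E_U[L_{W|U}(U,\rho)]\Big)\right)\right),$$ and moreover, for every $\rho>0$ (the bound that corresponds to $\alpha\to\infty$), $$R_B\ \ge\ \rho\left(1-\exp\Big(\mathcal L(W\to X|U)+\log\mathbb E_U[L_{W|U}(U,\rho)]\Big)\right).$$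 Here $\log 0=-\infty$, $\exp(-\infty)=0$, $\exp(+\infty)=+\infty$, $0\cdot(\pm\infty)=0$, and each inequality is asserted whenever the sum inside its exponential is not of the indeterminate form $(+\infty)+(-\infty)$. -/

import Mathlib

open MeasureTheory ProbabilityTheory
open scoped ENNReal NNReal

noncomputable section

/-- The Rényi divergence `D_α(P‖Q)`: for `α ≠ 1` it is `(α - 1)⁻¹ log ∫ p^α q^(1-α) dm`, where `p`
and `q` are the densities of `P` and `Q` with respect to the dominating measure `m = P + Q`; for
`α = 1` it is the Kullback-Leibler divergence. With the conventions of `ℝ≥0∞` one has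
`p^α * q^(1-α) = ∞` where `p > 0`, `q = 0`, `α > 1`, so the value is `⊤` if `P` is not absolutely
continuous with respect to `Q` and `α > 1`. -/
def renyiDivergence {E : Type*} [MeasurableSpace E] (α : ℝ) (P Q : Measure E) : EReal :=
  if α = 1 then (InformationTheory.klDiv P Q : EReal)
  else (((α - 1)⁻¹ : ℝ) : EReal) *
    ENNReal.log (∫⁻ e, P.rnDeriv (P + Q) e ^ α * Q.rnDeriv (P + Q) e ^ (1 - α) ∂(P + Q))

/-- The Bayesian risk `R_B = inf_φ E[ℓ(W, φ(X))]` for the prior `π = P_W` and the family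
`P = (P_{X|W=w})_w`; the infimum is over all measurable estimators `φ`. -/
def bayesianRisk {𝓦 𝓧 𝓦' : Type*} [MeasurableSpace 𝓦] [MeasurableSpace 𝓧] [MeasurableSpace 𝓦']
    (π : Measure 𝓦) (P : Kernel 𝓦 𝓧) (ℓ : 𝓦 → 𝓦' → ℝ≥0) : ℝ≥0∞ :=
  ⨅ (φ : 𝓧 → 𝓦') (_ : Measurable φ), ∫⁻ p, (ℓ p.1 (φ p.2) : ℝ≥0∞) ∂(π ⊗ₘ P)

/-- The joint law of `(U, (W, X))` when `W ∼ π`, `X ∼ P(· | W)` and `U ∼ κ(· | W, X)`. -/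
def jointLaw {𝓦 𝓧 𝓤 : Type*} [MeasurableSpace 𝓦] [MeasurableSpace 𝓧] [MeasurableSpace 𝓤]
    (π : Measure 𝓦) (P : Kernel 𝓦 𝓧) (κ : Kernel (𝓦 × 𝓧) 𝓤) : Measure (𝓤 × (𝓦 × 𝓧)) :=
  ((π ⊗ₘ P) ⊗ₘ κ).map Prod.swap

/-- `η` is a regular conditional distribution `P_{W|U}` of `W` given `U`, where `μ` is the law of
`(U, (W, X))`: the law of `(U, W)` is `P_U(du) η(u, dw)`. -/
def IsCondLawOfParam {𝓦 𝓧 𝓤 : Type*} [MeasurableSpace 𝓦] [MeasurableSpace 𝓧] [MeasurableSpace 𝓤]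
    (μ : Measure (𝓤 × (𝓦 × 𝓧))) (η : Kernel 𝓤 𝓦) : Prop :=
  (μ.map (fun p => (p.1, p.2.1))).IsCondKernel η

/-- The conditional Sibson mutual information
`I_α(W, X | U) = inf_Q D_α(P_{WXU} ‖ P_{W|U} Q_{X|U} P_U)`, where `μ` is the law of `(U, (W, X))`,
`η = P_{W|U}` and `Q` runs over all Markov kernels from `𝓤` to `𝓧`. -/
def condSibson {𝓦 𝓧 𝓤 : Type*} [MeasurableSpace 𝓦] [MeasurableSpace 𝓧] [MeasurableSpace 𝓤]
    (α : ℝ) (μ : Measure (𝓤 × (𝓦 × 𝓧))) (η : Kernel 𝓤 𝓦) : EReal :=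
  ⨅ (Q : Kernel 𝓤 𝓧) (_ : IsMarkovKernel Q), renyiDivergence α μ (μ.fst ⊗ₘ (η ×ₖ Q))

/-- The conditional small-ball probability
`L_{W|U}(u, ρ) = sup_{w'} P_{W|U=u}(ℓ(W, w') < ρ)`, where `η = P_{W|U}`. -/
def condSmallBall {𝓦 𝓤 𝓦' : Type*} [MeasurableSpace 𝓦] [MeasurableSpace 𝓤]
    (η : Kernel 𝓤 𝓦) (ℓ : 𝓦 → 𝓦' → ℝ≥0) (ρ : ℝ) (u : 𝓤) : ℝ≥0∞ :=
  ⨆ w' : 𝓦', η u {w | (ℓ w w' : ℝ) < ρ}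

/-- The joint law of `((U, (W, X)), T)` when `(U, (W, X)) ∼ μ` and `T` is drawn from `K(· | U, W)`.
These are exactly the joint laws for which `T - W - X` is a Markov chain given `U`. -/
def secretLaw {𝓦 𝓧 𝓤 : Type*} [MeasurableSpace 𝓦] [MeasurableSpace 𝓧] [MeasurableSpace 𝓤]
    (μ : Measure (𝓤 × (𝓦 × 𝓧))) {n : ℕ} (K : Kernel (𝓤 × 𝓦) (Fin n)) :
    Measure ((𝓤 × (𝓦 × 𝓧)) × Fin n) :=
  μ ⊗ₘ K.comap (fun p => (p.1, p.2.1)) (by fun_prop)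

/-- The conditional maximal leakage
`L(W → X | U) = sup_T log (P(T = T̂(X, U)) / P(T = T̃(U)))`, where `μ` is the law of `(U, (W, X))`,
`T` runs over all random variables with values in an arbitrary finite alphabet for which
`T - W - X` is a Markov chain given `U`, and `T̂`, `T̃` are optimal estimators of `T` given `(X, U)`
and given `U`: the two probabilities are the suprema over all measurable estimators. -/
def condMaxLeakage {𝓦 𝓧 𝓤 : Type*} [MeasurableSpace 𝓦] [MeasurableSpace 𝓧] [MeasurableSpace 𝓤]
    (μ : Measure (𝓤 × (𝓦 × 𝓧))) : EReal :=
  ⨆ (n : ℕ) (K : Kernel (𝓤 × 𝓦) (Fin n)) (_ : IsMarkovKernel K),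
    ENNReal.log
      ((⨆ (t : 𝓧 × 𝓤 → Fin n) (_ : Measurable t),
          secretLaw μ K {p | p.2 = t (p.1.2.2, p.1.1)}) /
        (⨆ (t : 𝓤 → Fin n) (_ : Measurable t),
          secretLaw μ K {p | p.2 = t p.1.1}))

end

/-! For an estimator `φ` let `S` be the event `ℓ(W, φ(X)) < ρ`. By Markov's inequality the expected
loss is at least `ρ (1 - P(S))`, so both bounds reduce to upper bounds on `P(S)` that are uniform in
`φ`.

Sibson bound: under `P_U P_{W|U} Q_{X|U}` the variables `W` and `X` are independent given `U`, so
fixing `X = x` turns `S` into a small ball around `φ(x)` and its probability is at most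
`E[L_{W|U}]`. Hölder's inequality transfers this to the true law at the cost of a Rényi divergence,
and the infimum over `Q` gives `I_α` (`measure_smallBall_le_exp_condSibson`).

Leakage bound: this is not taken as a limit `α → ∞` but read off the operational definition. If `S`
has finitely many sections over `𝓧`, a secret `T` is built that names one of these sections
containing `W`: knowing `X` it is guessed correctly on `S`, while a blind guess succeeds with
probability governed by the section's conditional probability (`measure_finite_sections_le`). A
general `S` is approximated in measure by such events
(`measure_snd_preimage_le_exp_condMaxLeakage`). -/

/-! ### Change of measure by Rényi divergence -/

/-- Hölder's inequality on an event, in terms of the Hellinger integral of order `α > 1`. -/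
theorem measure_le_hellinger_rpow_mul_rpow {E : Type*} [MeasurableSpace E] {α : ℝ} (hα : 1 < α)
    (P Q : Measure E) [IsFiniteMeasure P] [IsFiniteMeasure Q] {S : Set E}
    (hJ : ∫⁻ e, P.rnDeriv (P + Q) e ^ α * Q.rnDeriv (P + Q) e ^ (1 - α) ∂(P + Q) ≠ ⊤) :
    P S ≤ (∫⁻ e, P.rnDeriv (P + Q) e ^ α * Q.rnDeriv (P + Q) e ^ (1 - α) ∂(P + Q)) ^ α⁻¹
      * Q S ^ ((α - 1) / α) := by
  have hα0 : 0 < α := by linarith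
  set m := P + Q with hm
  have hP : P ≪ m := Measure.AbsolutelyContinuous.rfl.add_right Q
  have hQ : Q ≪ m := by rw [hm, add_comm]; exact Measure.AbsolutelyContinuous.rfl.add_right P
  set p := P.rnDeriv m
  set q := Q.rnDeriv m
  have hp : Measurable p := Measure.measurable_rnDeriv _ _
  have hq : Measurable q := Measure.measurable_rnDeriv _ _
  have hmeas : Measurable fun e => p e ^ α * q e ^ (1 - α) := by fun_prop
  have hfin : ∀ᵐ e ∂m, p e ^ α * q e ^ (1 - α) < ⊤ := ae_lt_top hmeas hJ
  have hqtop : ∀ᵐ e ∂m, q e < ⊤ := Measure.rnDeriv_lt_top _ _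
  rw [← Measure.setLIntegral_rnDeriv hP S, ← Measure.setLIntegral_rnDeriv hQ S]
  -- Hölder exponents `1/α` and `(α-1)/α`: the powers of `q` cancel where `q ≠ 0`, and finiteness of
  -- the Hellinger integral forces `p = 0` almost everywhere on `q = 0`.
  have key : ∀ᵐ e ∂m, p e ≤ (p e ^ α * q e ^ (1 - α)) ^ α⁻¹ * q e ^ ((α - 1) / α) := by
    filter_upwards [hfin, hqtop] with e h1 h2
    rcases eq_or_ne (q e) 0 with h0 | h0
    · rw [h0, ENNReal.zero_rpow_of_neg (by linarith)] at h1
      have : p e = 0 := by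
        by_contra hne
        rw [ENNReal.mul_top] at h1
        · exact lt_irrefl _ h1
        · simp [ENNReal.rpow_eq_zero_iff, hne, hα0.le]
      simp [this]
    · rw [ENNReal.mul_rpow_of_nonneg _ _ (by positivity), ← ENNReal.rpow_mul,
        ← ENNReal.rpow_mul, mul_assoc, ← ENNReal.rpow_add _ _ h0 h2.ne,
        mul_inv_cancel₀ hα0.ne', ENNReal.rpow_one]
      have : (1 - α) * α⁻¹ + (α - 1) / α = 0 := by ring
      simp [this]
  calc ∫⁻ e in S, p e ∂m
      ≤ ∫⁻ e in S, (p e ^ α * q e ^ (1 - α)) ^ α⁻¹ * q e ^ ((α - 1) / α) ∂m :=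
        lintegral_mono_ae (ae_restrict_of_ae key)
    _ ≤ (∫⁻ e in S, p e ^ α * q e ^ (1 - α) ∂m) ^ α⁻¹ * (∫⁻ e in S, q e ∂m) ^ ((α - 1) / α) :=
        ENNReal.lintegral_mul_norm_pow_le hmeas.aemeasurable hq.aemeasurable (by positivity)
          (div_nonneg (by linarith) hα0.le) (by field_simp; ring)
    _ ≤ _ := by
        gcongr
        exact Measure.restrict_le_self

/-- The change of measure inequality for events, in terms of the Rényi divergence. -/
theorem measure_le_exp_renyiDivergence {E : Type*} [MeasurableSpace E] {α : ℝ} (hα : 1 < α)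
    (P Q : Measure E) [IsFiniteMeasure P] [IsFiniteMeasure Q] {S : Set E} {y : ℝ≥0∞}
    (hy : Q S ≤ y) (h : renyiDivergence α P Q ≠ ⊤ ∨ y ≠ 0) :
    ENNReal.log (P S) ≤ (((α - 1) / α : ℝ) : EReal) * (renyiDivergence α P Q + ENNReal.log y) := by
  have hα0 : 0 < α := by linarith
  have hα1 : 0 < α - 1 := by linarith
  have hc : 0 < (α - 1) / α := div_pos hα1 hα0
  rw [renyiDivergence, if_neg hα.ne'] at h ⊢
  set J := ∫⁻ e, P.rnDeriv (P + Q) e ^ α * Q.rnDeriv (P + Q) e ^ (1 - α) ∂(P + Q) with hJdef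
  rcases eq_or_ne J ⊤ with hJ | hJ
  · have htop : (((α - 1)⁻¹ : ℝ) : EReal) * ENNReal.log J = ⊤ := by
      rw [hJ, ENNReal.log_top, EReal.coe_mul_top_of_pos (inv_pos.2 hα1)]
    rw [htop] at h ⊢
    have hy0 : y ≠ 0 := by simpa using h
    rw [EReal.top_add_of_ne_bot (by simpa using hy0), EReal.coe_mul_top_of_pos hc]
    exact le_top
  · have h1 := measure_le_hellinger_rpow_mul_rpow hα P Q (S := S) hJ
    rw [← hJdef] at h1
    have h2 : P S ≤ J ^ α⁻¹ * y ^ ((α - 1) / α) := h1.trans (by gcongr)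
    refine (ENNReal.log_le_log h2).trans ?_
    rw [ENNReal.log_mul_add, ENNReal.log_rpow, ENNReal.log_rpow,
      EReal.left_distrib_of_nonneg_of_ne_top (by exact_mod_cast hc.le) (EReal.coe_ne_top _),
      ← mul_assoc, ← EReal.coe_mul]
    have : (α - 1) / α * (α - 1)⁻¹ = α⁻¹ := by field_simp
    rw [this]

/-- Scaling by a positive real and adding a finite `b` are invertible, so the bound can be moved
onto `f i` alone. An infinite `b` breaks this, hence the separate treatment of a vanishing
small-ball probability later. -/
theorem EReal.le_coe_mul_iInf_add {ι : Sort*} {c : ℝ} (hc : 0 < c) {a b : EReal} {f : ι → EReal}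
    (hb : b ≠ ⊥) (hb' : b ≠ ⊤) (h : ∀ i, a ≤ c * (f i + b)) : a ≤ c * ((⨅ i, f i) + b) := by
  have hc' : (0 : EReal) < c := by exact_mod_cast hc
  rw [← EReal.div_le_iff_le_mul hc' (EReal.coe_ne_top _),
    ← EReal.sub_le_iff_le_add (.inl hb) (.inl hb')]
  refine le_iInf fun i => ?_
  rw [EReal.sub_le_iff_le_add (.inl hb) (.inl hb'),
    EReal.div_le_iff_le_mul hc' (EReal.coe_ne_top _)]
  exact h i

/-! ### From small-ball probabilities to the Bayesian risk; the Sibson bound -/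

section

variable {𝓦 𝓧 𝓦' 𝓤 : Type*} [MeasurableSpace 𝓦] [MeasurableSpace 𝓧] [MeasurableSpace 𝓤]

/-- Markov's inequality on the complementary event. When `x ≥ 1` the left side is nonpositive and
there is nothing to prove. -/
theorem coe_mul_one_sub_le_lintegral {E : Type*} [MeasurableSpace E] (μ : Measure E)
    [IsProbabilityMeasure μ] {f : E → ℝ≥0} (hf : Measurable f) {ρ : ℝ} (hρ : 0 < ρ) {x : ℝ≥0∞}
    (hx : μ {e | (f e : ℝ) < ρ} ≤ x) :
    (ρ : EReal) * (1 - (x : EReal)) ≤ ((∫⁻ e, f e ∂μ : ℝ≥0∞) : EReal) := by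
  have hρ' : (0 : EReal) < ρ := by exact_mod_cast hρ
  have hint : (0 : EReal) ≤ ((∫⁻ e, f e ∂μ : ℝ≥0∞) : EReal) := EReal.coe_ennreal_nonneg _
  rcases le_total 1 x with h1 | h1
  · have : (1 : EReal) - x ≤ 0 := by
      rw [EReal.sub_nonpos]; exact_mod_cast h1
    exact (EReal.mul_nonpos_iff.2 (.inl ⟨hρ'.le, this⟩)).trans hint
  · have hms : MeasurableSet {e | (f e : ℝ) < ρ} :=
      measurableSet_lt (by fun_prop) measurable_const
    have h2 : {e | (f e : ℝ) < ρ}ᶜ = {e | ENNReal.ofReal ρ ≤ (f e : ℝ≥0∞)} := by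
      ext e
      simp [ENNReal.ofReal_le_iff_le_toReal]
    have h3 := mul_meas_ge_le_lintegral (μ := μ) (f := fun e => (f e : ℝ≥0∞)) (by fun_prop)
      (ENNReal.ofReal ρ)
    rw [← h2, prob_compl_eq_one_sub hms] at h3
    have h4 : ENNReal.ofReal ρ * (1 - x) ≤ ∫⁻ e, f e ∂μ := le_trans (by gcongr) h3
    have h5 : ((ENNReal.ofReal ρ * (1 - x) : ℝ≥0∞) : EReal) = (ρ : EReal) * (1 - (x : EReal)) := by
      lift x to ℝ≥0 using ne_top_of_le_ne_top ENNReal.one_ne_top h1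
      have hx1 : x ≤ 1 := by exact_mod_cast h1
      have e1 : ENNReal.ofReal ρ * (1 - (x : ℝ≥0∞)) = ENNReal.ofReal (ρ * (1 - x)) := by
        rw [ENNReal.ofReal_mul hρ.le, ENNReal.ofReal_sub _ x.coe_nonneg]; simp
      rw [e1, EReal.coe_ennreal_ofReal, max_eq_left
        (mul_nonneg hρ.le (sub_nonneg.2 (by exact_mod_cast hx1)))]
      push_cast
      rfl
    rw [← h5]
    exact_mod_cast h4

/-- A bound on the small-loss probability of every estimator gives a bound on the Bayesian risk. -/
theorem coe_mul_one_sub_le_bayesianRisk [MeasurableSpace 𝓦'] (π : Measure 𝓦) [IsProbabilityMeasure π] (P : Kernel 𝓦 𝓧)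
    [IsMarkovKernel P] {ℓ : 𝓦 → 𝓦' → ℝ≥0} (hℓ : Measurable (Function.uncurry ℓ))
    {ρ : ℝ} (hρ : 0 < ρ) {x : ℝ≥0∞}
    (hx : ∀ φ : 𝓧 → 𝓦', Measurable φ → (π ⊗ₘ P) {p | (ℓ p.1 (φ p.2) : ℝ) < ρ} ≤ x) :
    (ρ : EReal) * (1 - (x : EReal)) ≤ (bayesianRisk π P ℓ : EReal) := by
  have key : ∀ φ : 𝓧 → 𝓦', Measurable φ → (ρ : EReal) * (1 - (x : EReal)) ≤
      ((∫⁻ p, (ℓ p.1 (φ p.2) : ℝ≥0∞) ∂(π ⊗ₘ P) : ℝ≥0∞) : EReal) := fun φ hφ =>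
    coe_mul_one_sub_le_lintegral _
      (hℓ.comp (measurable_fst.prodMk (hφ.comp measurable_snd))) hρ (hx φ hφ)
  rcases le_or_gt ((ρ : EReal) * (1 - (x : EReal))) 0 with h | h
  · exact h.trans (EReal.coe_ennreal_nonneg _)
  · generalize (ρ : EReal) * (1 - (x : EReal)) = r at key h
    rw [← EReal.coe_toENNReal h.le, EReal.coe_ennreal_le_coe_ennreal_iff]
    refine le_iInf₂ fun φ hφ => ?_
    rw [← EReal.coe_ennreal_le_coe_ennreal_iff, EReal.coe_toENNReal h.le]
    exact key φ hφ

instance isProbabilityMeasure_jointLaw (π : Measure 𝓦) [IsProbabilityMeasure π] (P : Kernel 𝓦 𝓧)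
    [IsMarkovKernel P] (κ : Kernel (𝓦 × 𝓧) 𝓤) [IsMarkovKernel κ] :
    IsProbabilityMeasure (jointLaw π P κ) :=
  Measure.isProbabilityMeasure_map measurable_swap.aemeasurable

theorem jointLaw_snd_preimage (π : Measure 𝓦) [IsProbabilityMeasure π] (P : Kernel 𝓦 𝓧)
    [IsMarkovKernel P] (κ : Kernel (𝓦 × 𝓧) 𝓤) [IsMarkovKernel κ] {S : Set (𝓦 × 𝓧)}
    (hS : MeasurableSet S) : jointLaw π P κ (Prod.snd ⁻¹' S) = (π ⊗ₘ P) S := by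
  rw [← Measure.map_apply measurable_snd hS, jointLaw,
    Measure.map_map measurable_snd measurable_swap]
  change ((π ⊗ₘ P) ⊗ₘ κ).fst S = _
  rw [Measure.fst_compProd]

/-- Conditional independence given `U` allows integrating over `W` first with `x` fixed; the section
at `x` is the small ball around `φ x`. -/
theorem compProd_prod_smallBall_le (m : Measure 𝓤) [IsFiniteMeasure m] (η : Kernel 𝓤 𝓦)
    [IsMarkovKernel η] (Q : Kernel 𝓤 𝓧) [IsMarkovKernel Q] {ℓ : 𝓦 → 𝓦' → ℝ≥0}
    {ρ : ℝ} {φ : 𝓧 → 𝓦'} (hS : MeasurableSet {p : 𝓦 × 𝓧 | (ℓ p.1 (φ p.2) : ℝ) < ρ}) :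
    (m ⊗ₘ (η ×ₖ Q)) (Prod.snd ⁻¹' {p : 𝓦 × 𝓧 | (ℓ p.1 (φ p.2) : ℝ) < ρ})
      ≤ ∫⁻ u, condSmallBall η ℓ ρ u ∂m := by
  rw [Measure.compProd_apply (measurable_snd hS)]
  refine lintegral_mono fun u => ?_
  rw [← Set.preimage_comp, Kernel.prod_apply]
  change ((η u).prod (Q u)) {p : 𝓦 × 𝓧 | (ℓ p.1 (φ p.2) : ℝ) < ρ} ≤ _
  rw [Measure.prod_apply_symm hS]
  calc _ ≤ ∫⁻ _, condSmallBall η ℓ ρ u ∂(Q u) :=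
        lintegral_mono fun x => le_iSup (fun w' => η u {w | (ℓ w w' : ℝ) < ρ}) (φ x)
    _ = _ := by simp

theorem condSmallBall_le_one (η : Kernel 𝓤 𝓦) [IsMarkovKernel η] (ℓ : 𝓦 → 𝓦' → ℝ≥0) (ρ : ℝ)
    (u : 𝓤) : condSmallBall η ℓ ρ u ≤ 1 := iSup_le fun _ => prob_le_one

theorem measure_smallBall_le_exp_condSibson (μ : Measure (𝓤 × (𝓦 × 𝓧))) [IsProbabilityMeasure μ]
    (η : Kernel 𝓤 𝓦) [IsMarkovKernel η] {ℓ : 𝓦 → 𝓦' → ℝ≥0} {ρ : ℝ} {φ : 𝓧 → 𝓦'}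
    (hS : MeasurableSet {p : 𝓦 × 𝓧 | (ℓ p.1 (φ p.2) : ℝ) < ρ}) {α : ℝ} (hα : 1 < α)
    (h : condSibson α μ η ≠ ⊤ ∨ ∫⁻ u, condSmallBall η ℓ ρ u ∂μ.fst ≠ 0) :
    μ (Prod.snd ⁻¹' {p : 𝓦 × 𝓧 | (ℓ p.1 (φ p.2) : ℝ) < ρ}) ≤
      EReal.exp ((((α - 1) / α : ℝ) : EReal) * (condSibson α μ η +
        ENNReal.log (∫⁻ u, condSmallBall η ℓ ρ u ∂μ.fst))) := by
  have hc : 0 < (α - 1) / α := div_pos (by linarith) (by linarith)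
  rw [← ENNReal.log_le_log_iff, EReal.log_exp]
  set S := {p : 𝓦 × 𝓧 | (ℓ p.1 (φ p.2) : ℝ) < ρ}
  set y := ∫⁻ u, condSmallBall η ℓ ρ u ∂μ.fst with hy
  have hytop : y ≠ ⊤ := by
    refine ne_top_of_le_ne_top ENNReal.one_ne_top ?_
    calc y ≤ ∫⁻ _, 1 ∂μ.fst := lintegral_mono fun u => condSmallBall_le_one η ℓ ρ u
      _ = 1 := by simp
  have hle : ∀ (Q : Kernel 𝓤 𝓧), IsMarkovKernel Q →
      (μ.fst ⊗ₘ (η ×ₖ Q)) (Prod.snd ⁻¹' S) ≤ y := fun Q _ =>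
    compProd_prod_smallBall_le μ.fst η Q hS
  rcases eq_or_ne y 0 with h0 | h0
  -- Here the logarithm is `⊥`, so a single `Q` of finite divergence already forces the event to be
  -- null.
  · have hne : condSibson α μ η ≠ ⊤ := by simpa [h0] using h
    obtain ⟨Q, hQ, hD⟩ : ∃ Q : Kernel 𝓤 𝓧, ∃ _ : IsMarkovKernel Q,
        renyiDivergence α μ (μ.fst ⊗ₘ (η ×ₖ Q)) ≠ ⊤ := by
      by_contra! hcon
      exact hne (by simpa [condSibson] using hcon)
    have := measure_le_exp_renyiDivergence hα μ _ (hle Q hQ) (.inl hD)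
    rw [h0, ENNReal.log_zero, EReal.add_bot] at this ⊢
    exact this
  · rw [condSibson, iInf_subtype']
    refine EReal.le_coe_mul_iInf_add hc (by simpa using h0) (by simpa using hytop) ?_
    rintro ⟨Q, hQ⟩
    exact measure_le_exp_renyiDivergence hα μ _ (hle Q hQ) (.inr h0)

end

/-! ### Conditional maximal leakage: secrets on a finite alphabet -/

section

open scoped symmDiff Topology

variable {𝓦 𝓧 𝓤 : Type*} [MeasurableSpace 𝓦] [MeasurableSpace 𝓧] [MeasurableSpace 𝓤]

/-- The kernel to a finite alphabet with the given measurable weights. -/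
noncomputable def weightKernel {E : Type*} [MeasurableSpace E] {n : ℕ} (g : Fin n → E → ℝ≥0∞)
    (hg : ∀ i, Measurable (g i)) : Kernel E (Fin n) where
  toFun a := ∑ i, g i a • Measure.dirac i
  measurable' := by
    refine Measure.measurable_of_measurable_coe _ fun s _ => ?_
    simp only [Measure.coe_finsetSum, Finset.sum_apply, Measure.smul_apply, smul_eq_mul]
    exact Finset.measurable_sum _ fun i _ => (hg i).mul_const _

theorem weightKernel_singleton {E : Type*} [MeasurableSpace E] {n : ℕ} (g : Fin n → E → ℝ≥0∞)
    (hg : ∀ i, Measurable (g i)) (a : E) (i : Fin n) : weightKernel g hg a {i} = g i a := by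
  change (∑ j, g j a • Measure.dirac j : Measure (Fin n)) {i} = g i a
  simp [Finset.sum_apply, Set.indicator_apply]

theorem isMarkovKernel_weightKernel {E : Type*} [MeasurableSpace E] {n : ℕ}
    (g : Fin n → E → ℝ≥0∞) (hg : ∀ i, Measurable (g i)) (h1 : ∀ a, ∑ i, g i a = 1) :
    IsMarkovKernel (weightKernel g hg) := by
  refine ⟨fun a => ⟨?_⟩⟩
  change (∑ j, g j a • Measure.dirac j : Measure (Fin n)) Set.univ = 1
  simp [Finset.sum_apply, h1]

theorem secretLaw_apply_eq (μ : Measure (𝓤 × (𝓦 × 𝓧))) [IsProbabilityMeasure μ] {n : ℕ}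
    (K : Kernel (𝓤 × 𝓦) (Fin n)) [IsMarkovKernel K] {f : 𝓤 × (𝓦 × 𝓧) → Fin n}
    (hf : Measurable f) :
    secretLaw μ K {p | p.2 = f p.1} = ∫⁻ p, K (p.1, p.2.1) {f p} ∂μ := by
  have hS : MeasurableSet {p : (𝓤 × (𝓦 × 𝓧)) × Fin n | p.2 = f p.1} :=
    measurableSet_eq_fun measurable_snd (hf.comp measurable_fst)
  rw [secretLaw, Measure.compProd_apply hS]
  rfl

theorem lintegral_eq_of_isCondLawOfParam {μ : Measure (𝓤 × (𝓦 × 𝓧))} [IsProbabilityMeasure μ]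
    {η : Kernel 𝓤 𝓦} [IsMarkovKernel η] (hη : IsCondLawOfParam μ η) {f : 𝓤 × 𝓦 → ℝ≥0∞}
    (hf : Measurable f) :
    ∫⁻ p, f (p.1, p.2.1) ∂μ = ∫⁻ u, ∫⁻ w, f (u, w) ∂(η u) ∂μ.fst := by
  have hm : Measurable fun p : 𝓤 × (𝓦 × 𝓧) => (p.1, p.2.1) := by fun_prop
  have hfst : (μ.map fun p => (p.1, p.2.1)).fst = μ.fst := by
    rw [Measure.fst, Measure.map_map measurable_fst hm]; rfl
  have := hη.disintegrate
  rw [hfst] at this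
  rw [← lintegral_map hf hm, ← this, Measure.lintegral_compProd hf]

/-- The conditional maximal leakage bounds the advantage in guessing a secret that is drawn from
given weights on a finite alphabet. -/
theorem lintegral_weight_le_exp_condMaxLeakage {μ : Measure (𝓤 × (𝓦 × 𝓧))}
    [IsProbabilityMeasure μ] {η : Kernel 𝓤 𝓦} [IsMarkovKernel η] (hη : IsCondLawOfParam μ η)
    (hC : condMaxLeakage μ ≠ ⊤) {ι : Type*} [Fintype ι] {g : ι → 𝓤 × 𝓦 → ℝ≥0∞}
    (hg : ∀ i, Measurable (g i)) (h1 : ∀ a, ∑ i, g i a = 1) {t : 𝓧 × 𝓤 → ι}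
    (ht : ∀ i, MeasurableSet (t ⁻¹' {i})) {b : 𝓤 → ℝ≥0∞}
    (hb : ∀ i u, ∫⁻ w, g i (u, w) ∂(η u) ≤ b u) :
    ∫⁻ p, g (t (p.2.2, p.1)) (p.1, p.2.1) ∂μ ≤
      EReal.exp (condMaxLeakage μ) * ∫⁻ u, b u ∂μ.fst := by
  let e := Fintype.equivFin ι
  let g' : Fin (Fintype.card ι) → 𝓤 × 𝓦 → ℝ≥0∞ := fun j => g (e.symm j)
  have hg' : ∀ j, Measurable (g' j) := fun j => hg _
  have h1' : ∀ a, ∑ j, g' j a = 1 := fun a => by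
    rw [← h1 a]; exact Equiv.sum_comp e.symm fun i => g i a
  let K := weightKernel g' hg'
  have hK : IsMarkovKernel K := isMarkovKernel_weightKernel g' hg' h1'
  have het : Measurable (e ∘ t) := measurable_to_countable' fun j => by
    convert ht (e.symm j) using 1
    ext p; simp [Equiv.eq_symm_apply]
  set A := ⨆ (t : 𝓧 × 𝓤 → Fin (Fintype.card ι)) (_ : Measurable t),
          secretLaw μ K {p | p.2 = t (p.1.2.2, p.1.1)} with hA
  set B := ⨆ (t : 𝓤 → Fin (Fintype.card ι)) (_ : Measurable t),
          secretLaw μ K {p | p.2 = t p.1.1} with hB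
  have hAB : A / B ≤ EReal.exp (condMaxLeakage μ) := by
    rw [← ENNReal.log_le_log_iff, EReal.log_exp, condMaxLeakage]
    exact le_iSup_of_le (Fintype.card ι) (le_iSup_of_le K (le_iSup_of_le hK le_rfl))
  -- Finiteness of the leakage is what makes clearing the denominator valid even if `B = 0`.
  have hAB' : A ≤ EReal.exp (condMaxLeakage μ) * B := by
    have hCtop : EReal.exp (condMaxLeakage μ) ≠ ⊤ := by simpa using hC
    have hBtop : B ≠ ⊤ := by
      have : IsProbabilityMeasure (secretLaw μ K) := by unfold secretLaw; infer_instance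
      exact ne_top_of_le_ne_top ENNReal.one_ne_top (iSup₂_le fun _ _ => prob_le_one)
    exact (ENNReal.div_le_iff_le_mul (.inr hCtop) (.inl hBtop)).1 hAB
  have hle : ∫⁻ p, g (t (p.2.2, p.1)) (p.1, p.2.1) ∂μ ≤ A := by
    refine le_trans (le_of_eq ?_) (le_iSup₂ (e ∘ t) het)
    rw [secretLaw_apply_eq μ K (f := fun p => (e ∘ t) (p.2.2, p.1))
      (het.comp (by fun_prop))]
    simp [K, weightKernel_singleton, g']
  -- A blind guess depends on `u` only, so given `U = u` it succeeds with the `η u`-average of one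
  -- fixed weight.
  have hBle : B ≤ ∫⁻ u, b u ∂μ.fst := by
    refine iSup₂_le fun s hs => ?_
    rw [secretLaw_apply_eq μ K (f := fun p => s p.1) (by fun_prop)]
    simp only [K, weightKernel_singleton]
    have hgm : Measurable fun q : Fin (Fintype.card ι) × (𝓤 × 𝓦) => g' q.1 q.2 :=
      measurable_from_prod_countable_right hg'
    rw [lintegral_eq_of_isCondLawOfParam hη (f := fun q => g' (s q.1) q)
      (hgm.comp ((hs.comp measurable_fst).prodMk measurable_id))]
    exact lintegral_mono fun u => hb (e.symm (s u)) u
  exact hle.trans (hAB'.trans (by gcongr))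

/-- The leakage bound for an event whose sections over `𝓧` take finitely many values. -/
theorem measure_finite_sections_le {μ : Measure (𝓤 × (𝓦 × 𝓧))}
    [IsProbabilityMeasure μ] {η : Kernel 𝓤 𝓦} [IsMarkovKernel η] (hη : IsCondLawOfParam μ η)
    (hC : condMaxLeakage μ ≠ ⊤) {ι : Type*} [Fintype ι] [MeasurableSpace ι]
    [MeasurableSingletonClass ι] {c : 𝓧 → ι} (hc : Measurable c) {A : ι → Set 𝓦}
    (hA : ∀ i, MeasurableSet (A i)) {b : 𝓤 → ℝ≥0∞} (hb : Measurable b) :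
    μ {p | p.2.1 ∈ A (c p.2.2) ∧ η p.1 (A (c p.2.2)) ≤ b p.1} ≤
      EReal.exp (condMaxLeakage μ) * ∫⁻ u, b u ∂μ.fst := by
  have hX : Nonempty (𝓤 × (𝓦 × 𝓧)) := nonempty_of_isProbabilityMeasure μ
  have hι : Nonempty ι := ⟨c hX.some.2.2⟩
  have hCtop : EReal.exp (condMaxLeakage μ) ≠ ⊤ := by simpa using hC
  set C := EReal.exp (condMaxLeakage μ) with hCdef
  set N : ℝ≥0∞ := ((Fintype.card ι : ℕ) : ℝ≥0∞) with hN
  have hN0 : N ≠ 0 := by simp [hN]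
  have hNtop : N ≠ ⊤ := by simp [hN]
  -- Each section is discarded at those `u` where its probability exceeds the budget `b u`, so that
  -- the bound on a blind guess holds at every `u`.
  let G : ι → Set (𝓤 × 𝓦) := fun i => {a | a.2 ∈ A i ∧ η a.1 (A i) ≤ b a.1}
  have hG : ∀ i, MeasurableSet (G i) := fun i =>
    (measurable_snd (hA i)).inter (measurableSet_le
      ((η.measurable_coe (hA i)).comp measurable_fst) (hb.comp measurable_fst))
  let f : ι → 𝓤 × 𝓦 → ℝ≥0∞ := fun i => (G i).indicator fun _ => N⁻¹
  have hf : ∀ i, Measurable (f i) := fun i => measurable_const.indicator (hG i)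
  have hsum : ∀ a, ∑ i, f i a ≤ 1 := fun a => by
    calc ∑ i, f i a ≤ ∑ _i : ι, N⁻¹ :=
          Finset.sum_le_sum fun i _ => Set.indicator_le_self' (fun _ _ => zero_le) a
      _ = 1 := by simp [← hN, ENNReal.mul_inv_cancel hN0 hNtop]
  have key : ∀ M : ℕ, 1 ≤ M →
      μ {p | p.2.1 ∈ A (c p.2.2) ∧ η p.1 (A (c p.2.2)) ≤ b p.1} ≤
        C * (∫⁻ u, b u ∂μ.fst + N * (M : ℝ≥0∞)⁻¹) := by
    intro M hM
    have hM0 : (M : ℝ≥0∞) ≠ 0 := by simp; omega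
    have hMtop : (M : ℝ≥0∞) ≠ ⊤ := by simp
    -- The weights `f` only sum to at most one. The missing mass is spread evenly over `M` dummy
    -- letters, each of weight at most `1/M`; after multiplication by `N` the error `N/M` vanishes
    -- as `M → ∞`.
    let g : ι ⊕ Fin M → 𝓤 × 𝓦 → ℝ≥0∞ :=
      Sum.elim f fun _ a => (1 - ∑ i, f i a) * (M : ℝ≥0∞)⁻¹
    have hg : ∀ i, Measurable (g i) := by
      rintro (i | j)
      · exact hf i
      · exact (measurable_const.sub (Finset.measurable_sum _ fun i _ => hf i)).mul_const _
    have h1 : ∀ a, ∑ i, g i a = 1 := fun a => by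
      simp only [g, Fintype.sum_sum_type, Sum.elim_inl, Sum.elim_inr, Finset.sum_const,
        Finset.card_univ, Fintype.card_fin, nsmul_eq_mul]
      rw [mul_left_comm, ENNReal.mul_inv_cancel hM0 hMtop, mul_one,
        add_tsub_cancel_of_le (hsum a)]
    have hbound : ∀ i u, ∫⁻ w, g i (u, w) ∂(η u) ≤ N⁻¹ * b u + (M : ℝ≥0∞)⁻¹ := by
      rintro (i | j) u
      · refine le_trans ?_ le_self_add
        have : ∀ w, g (Sum.inl i) (u, w) = (Prod.mk u ⁻¹' G i).indicator (fun _ => N⁻¹) w :=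
          fun _ => rfl
        simp_rw [this]
        rw [lintegral_indicator_const (measurable_prodMk_left (hG i))]
        gcongr
        by_cases h : η u (A i) ≤ b u
        · exact (measure_mono fun w hw => hw.1).trans h
        · have : Prod.mk u ⁻¹' G i = ∅ := by ext w; simp [G, h]
          simp [this]
      · refine le_trans ?_ le_add_self
        calc ∫⁻ w, g (Sum.inr j) (u, w) ∂(η u) ≤ ∫⁻ _, 1 * (M : ℝ≥0∞)⁻¹ ∂(η u) :=
              lintegral_mono fun w => by
                simp only [g, Sum.elim_inr]
                gcongr
                exact tsub_le_self
          _ = _ := by simp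
    have ht : ∀ i, MeasurableSet ((fun p : 𝓧 × 𝓤 => (Sum.inl (c p.1) : ι ⊕ Fin M)) ⁻¹' {i}) := by
      rintro (i | j)
      · convert (hc.comp measurable_fst) (measurableSet_singleton i) using 1
        ext p; simp
      · convert MeasurableSet.empty
        ext p; simp
    have := lintegral_weight_le_exp_condMaxLeakage hη hC hg h1 ht hbound
    have e1 : ∀ p : 𝓤 × (𝓦 × 𝓧), g (Sum.inl (c p.2.2)) (p.1, p.2.1) =
        {p : 𝓤 × (𝓦 × 𝓧) | p.2.1 ∈ A (c p.2.2) ∧ η p.1 (A (c p.2.2)) ≤ b p.1}.indicator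
          (fun _ => N⁻¹) p := fun _ => rfl
    have hms : MeasurableSet
        {p : 𝓤 × (𝓦 × 𝓧) | p.2.1 ∈ A (c p.2.2) ∧ η p.1 (A (c p.2.2)) ≤ b p.1} := by
      have h2 : MeasurableSet {q : ι × (𝓤 × 𝓦) | q.2 ∈ G q.1} := by
        have : Measurable fun q : ι × (𝓤 × 𝓦) => q.2 ∈ G q.1 :=
          measurable_from_prod_countable_right fun i => (hG i).mem
        exact measurableSet_setOfPred.2 this
      exact (show Measurable fun p : 𝓤 × (𝓦 × 𝓧) => (c p.2.2, (p.1, p.2.1)) by fun_prop) h2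
    simp_rw [e1] at this
    rw [lintegral_indicator_const hms, lintegral_add_right _ measurable_const,
      lintegral_const_mul _ hb] at this
    simp only [lintegral_const, measure_univ, mul_one] at this
    calc _ = N * (N⁻¹ * μ {p | p.2.1 ∈ A (c p.2.2) ∧ η p.1 (A (c p.2.2)) ≤ b p.1}) := by
          rw [← mul_assoc, ENNReal.mul_inv_cancel hN0 hNtop, one_mul]
      _ ≤ N * (C * (N⁻¹ * ∫⁻ u, b u ∂μ.fst + (M : ℝ≥0∞)⁻¹)) := by gcongr
      _ = C * (N * N⁻¹ * ∫⁻ u, b u ∂μ.fst + N * (M : ℝ≥0∞)⁻¹) := by ring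
      _ = _ := by rw [ENNReal.mul_inv_cancel hN0 hNtop, one_mul]
  have hlim : Filter.Tendsto (fun M : ℕ => C * (∫⁻ u, b u ∂μ.fst + N * (M : ℝ≥0∞)⁻¹))
      Filter.atTop (𝓝 (C * (∫⁻ u, b u ∂μ.fst + N * 0))) :=
    ENNReal.Tendsto.const_mul (tendsto_const_nhds.add
      (ENNReal.Tendsto.const_mul ENNReal.tendsto_inv_nat_nhds_zero (.inr hNtop))) (.inr hCtop)
  rw [mul_zero, add_zero] at hlim
  exact ge_of_tendsto hlim (Filter.eventually_atTop.2 ⟨1, key⟩)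

/-! ### Approximation by sets with finitely many sections -/

/-- Sets in a product whose sections over the second factor take finitely many values. -/
def finiteSectionSets (𝓦 𝓧 : Type*) [MeasurableSpace 𝓦] [MeasurableSpace 𝓧] : Set (Set (𝓦 × 𝓧)) :=
  {S | ∃ (ι : Type) (_ : Fintype ι) (_ : MeasurableSpace ι) (_ : MeasurableSingletonClass ι)
    (c : 𝓧 → ι) (A : ι → Set 𝓦), Measurable c ∧ (∀ i, MeasurableSet (A i)) ∧
      S = {p | p.1 ∈ A (c p.2)}}

/-- The pair of labels `(c x, c' x)` is again a finite label, and it determines both sections at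
`x`. -/
theorem isSetRing_finiteSectionSets : IsSetRing (finiteSectionSets 𝓦 𝓧) where
  empty_mem := ⟨Unit, inferInstance, inferInstance, inferInstance, fun _ => (), fun _ => ∅,
    measurable_const, fun _ => MeasurableSet.empty, by simp⟩
  union_mem := by
    rintro _ _ ⟨ι, _, _, _, c, A, hc, hA, rfl⟩ ⟨ι', _, _, _, c', A', hc', hA', rfl⟩
    exact ⟨ι × ι', inferInstance, inferInstance, inferInstance, fun x => (c x, c' x),
      fun i => A i.1 ∪ A' i.2, hc.prodMk hc', fun i => (hA _).union (hA' _), rfl⟩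
  sdiff_mem := by
    rintro _ _ ⟨ι, _, _, _, c, A, hc, hA, rfl⟩ ⟨ι', _, _, _, c', A', hc', hA', rfl⟩
    exact ⟨ι × ι', inferInstance, inferInstance, inferInstance, fun x => (c x, c' x),
      fun i => A i.1 \ A' i.2, hc.prodMk hc', fun i => (hA _).diff (hA' _), rfl⟩

theorem prod_mem_finiteSectionSets {s : Set 𝓦} {t : Set 𝓧} (hs : MeasurableSet s)
    (ht : MeasurableSet t) : s ×ˢ t ∈ finiteSectionSets 𝓦 𝓧 :=
  ⟨Prop, inferInstance, inferInstance, inferInstance, fun x => x ∈ t, fun q => {w | w ∈ s ∧ q},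
    ht.mem, fun q => hs.inter (MeasurableSet.const q), by ext p; simp⟩

theorem measurableSet_finite_sections {ι : Type*} [Countable ι] [MeasurableSpace ι]
    [MeasurableSingletonClass ι] {c : 𝓧 → ι} (hc : Measurable c) {A : ι → Set 𝓦}
    (hA : ∀ i, MeasurableSet (A i)) : MeasurableSet {p : 𝓦 × 𝓧 | p.1 ∈ A (c p.2)} := by
  have h : Measurable fun q : ι × 𝓦 => q.2 ∈ A q.1 :=
    measurable_from_prod_countable_right fun i => (hA i).mem
  exact measurableSet_setOfPred.2
    (h.comp ((hc.comp measurable_snd).prodMk measurable_fst))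

theorem generateFrom_finiteSectionSets :
    (inferInstance : MeasurableSpace (𝓦 × 𝓧)) =
      MeasurableSpace.generateFrom (finiteSectionSets 𝓦 𝓧) := by
  apply le_antisymm
  · rw [← generateFrom_prod]
    refine MeasurableSpace.generateFrom_mono ?_
    rintro _ ⟨s, hs, t, ht, rfl⟩
    exact prod_mem_finiteSectionSets hs ht
  · refine MeasurableSpace.generateFrom_le ?_
    rintro _ ⟨ι, _, _, _, c, A, hc, hA, rfl⟩
    exact measurableSet_finite_sections hc hA

theorem exists_finiteSectionSets_measure_symmDiff_lt (m : Measure (𝓦 × 𝓧)) [IsFiniteMeasure m]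
    {S : Set (𝓦 × 𝓧)} (hS : MeasurableSet S) {ε : ℝ≥0∞} (hε : 0 < ε) :
    ∃ T ∈ finiteSectionSets 𝓦 𝓧, m (T ∆ S) < ε := by
  refine exists_measure_symmDiff_lt_of_generateFrom_isSetRing isSetRing_finiteSectionSets
    ⟨{Set.univ}, Set.countable_singleton _, ?_, by simp⟩ generateFrom_finiteSectionSets hS hε
  rw [Set.singleton_subset_iff, ← Set.univ_prod_univ]
  exact prod_mem_finiteSectionSets MeasurableSet.univ MeasurableSet.univ

/-- The leakage bound for an event on `𝓦 × 𝓧` whose sections over `𝓧` have conditional probability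
at most `L u` given `U = u`. -/
theorem measure_snd_preimage_le_exp_condMaxLeakage {μ : Measure (𝓤 × (𝓦 × 𝓧))}
    [IsProbabilityMeasure μ] {η : Kernel 𝓤 𝓦} [IsMarkovKernel η] (hη : IsCondLawOfParam μ η)
    (hC : condMaxLeakage μ ≠ ⊤) {S : Set (𝓦 × 𝓧)} (hS : MeasurableSet S) {L : 𝓤 → ℝ≥0∞}
    (hL : Measurable L) (hSL : ∀ᵐ u ∂μ.fst, ∀ x, η u {w | (w, x) ∈ S} ≤ L u) :
    μ (Prod.snd ⁻¹' S) ≤ EReal.exp (condMaxLeakage μ) * ∫⁻ u, L u ∂μ.fst := by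
  have hCtop : EReal.exp (condMaxLeakage μ) ≠ ⊤ := by simpa using hC
  set C := EReal.exp (condMaxLeakage μ) with hCdef
  have hux : Measurable fun p : 𝓤 × (𝓦 × 𝓧) => (p.1, p.2.2) := by fun_prop
  set m : Measure (𝓤 × 𝓧) := μ.map fun p => (p.1, p.2.2) with hm
  have : IsProbabilityMeasure m := Measure.isProbabilityMeasure_map hux.aemeasurable
  have hmfst : m.fst = μ.fst := by
    rw [hm, Measure.fst, Measure.map_map measurable_fst hux]; rfl
  -- `ν` is the law of `(W, X)` after `W` is redrawn from `η` given `U`, independently of `X`.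
  -- Closeness under `ν` controls the conditional probabilities of the sections, closeness under
  -- `μ.snd` the event itself.
  set ν : Measure (𝓦 × 𝓧) :=
    (m ⊗ₘ η.comap Prod.fst measurable_fst).map fun q => (q.2, q.1.2) with hν
  have hνm : Measurable fun q : (𝓤 × 𝓧) × 𝓦 => (q.2, q.1.2) := by fun_prop
  have hν_apply : ∀ T : Set (𝓦 × 𝓧), MeasurableSet T →
      ν T = ∫⁻ q, η q.1 {w | (w, q.2) ∈ T} ∂m := fun T hT => by
    rw [hν, Measure.map_apply hνm hT, Measure.compProd_apply (hνm hT)]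
    rfl
  have hSm : ∀ᵐ q ∂m, ∀ x, η q.1 {w | (w, x) ∈ S} ≤ L q.1 := by
    rw [← hmfst] at hSL
    exact ae_of_ae_map measurable_fst.aemeasurable hSL
  have key : ∀ δ : ℝ≥0∞, δ ≠ 0 → δ ≠ ⊤ →
      μ (Prod.snd ⁻¹' S) ≤ δ * δ + (C * (∫⁻ u, L u ∂μ.fst + δ) + δ) := by
    intro δ h0 htop
    obtain ⟨_, ⟨ι, _, _, _, c, A, hc, hA, rfl⟩, hlt⟩ :=
      exists_finiteSectionSets_measure_symmDiff_lt (μ.snd + ν) hS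
        -- The square is needed because Markov's inequality at level `δ` costs one factor `δ` when
        -- bounding the exceptional set `D`.
        (ε := δ * δ) (ENNReal.mul_pos h0 h0)
    set T := {p : 𝓦 × 𝓧 | p.1 ∈ A (c p.2)} with hTdef
    have hT : MeasurableSet T := measurableSet_finite_sections hc hA
    rw [Measure.add_apply] at hlt
    have hμ : μ (Prod.snd ⁻¹' (S \ T)) ≤ δ * δ := by
      rw [← Measure.snd_apply (hS.diff hT)]
      exact (measure_mono Set.subset_union_right).trans (le_self_add.trans hlt.le)
    have hνle : ν (T \ S) ≤ δ * δ :=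
      (measure_mono Set.subset_union_left).trans (le_add_self.trans hlt.le)
    -- On `D` the section of `T` exceeds the budget `L u + δ`; as that of `S` is at most `L u`,
    -- almost surely the section of `T \ S` has probability at least `δ` there.
    set D : Set (𝓤 × 𝓧) := {q | L q.1 + δ < η q.1 (A (c q.2))} with hD
    have hηA : Measurable fun q : 𝓤 × 𝓧 => η q.1 (A (c q.2)) := by
      have : Measurable fun r : ι × 𝓤 => η r.2 (A r.1) :=
        measurable_from_prod_countable_right fun i => η.measurable_coe (hA i)
      exact this.comp ((hc.comp measurable_snd).prodMk measurable_fst)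
    have hDm : MeasurableSet D :=
      measurableSet_lt ((hL.comp measurable_fst).add_const δ) hηA
    have hmD : m D ≤ δ := by
      have hdiff : Measurable fun q : 𝓤 × 𝓧 => η q.1 {w | (w, q.2) ∈ T \ S} :=
        Kernel.measurable_kernel_prodMk_left
          (κ := η.comap (Prod.fst : 𝓤 × 𝓧 → 𝓤) measurable_fst) (hνm (hT.diff hS))
      have h1 : m D ≤ m {q | δ ≤ η q.1 {w | (w, q.2) ∈ T \ S}} := by
        refine measure_mono_ae ?_
        filter_upwards [hSm] with q hq hqD
        have h2 : η q.1 (A (c q.2)) ≤ η q.1 {w | (w, q.2) ∈ S} +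
            η q.1 {w | (w, q.2) ∈ T \ S} := by
          refine (measure_mono fun w hw => ?_).trans (measure_union_le _ _)
          by_cases h : (w, q.2) ∈ S
          · exact .inl h
          · exact .inr ⟨hw, h⟩
        have h3 : L q.1 + δ < L q.1 + η q.1 {w | (w, q.2) ∈ T \ S} :=
          lt_of_lt_of_le hqD (h2.trans (by gcongr; exact hq _))
        exact (lt_of_add_lt_add_left h3).le
      have h4 := mul_meas_ge_le_lintegral (μ := m) hdiff δ
      rw [← hν_apply _ (hT.diff hS)] at h4
      have h5 : δ * m D ≤ δ * δ := (by gcongr : δ * m D ≤ _).trans (h4.trans hνle)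
      exact (ENNReal.mul_le_mul_iff_right h0 htop).1 h5
    have hB := measure_finite_sections_le hη hC hc hA (hL.add_const δ)
    rw [lintegral_add_right _ measurable_const] at hB
    simp only [lintegral_const, measure_univ, mul_one] at hB
    have hμD : μ ((fun p : 𝓤 × (𝓦 × 𝓧) => (p.1, p.2.2)) ⁻¹' D) ≤ δ := by
      rw [← Measure.map_apply hux hDm]; exact hmD
    calc μ (Prod.snd ⁻¹' S)
        ≤ μ (Prod.snd ⁻¹' (S \ T) ∪
            ({p | p.2.1 ∈ A (c p.2.2) ∧ η p.1 (A (c p.2.2)) ≤ L p.1 + δ} ∪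
              (fun p : 𝓤 × (𝓦 × 𝓧) => (p.1, p.2.2)) ⁻¹' D)) := by
          refine measure_mono fun p hp => ?_
          by_cases hpT : p.2 ∈ T
          · rcases le_or_gt (η p.1 (A (c p.2.2))) (L p.1 + δ) with h | h
            · exact .inr (.inl ⟨hpT, h⟩)
            · exact .inr (.inr h)
          · exact .inl ⟨hp, hpT⟩
      _ ≤ _ := (measure_union_le _ _).trans
          (add_le_add hμ ((measure_union_le _ _).trans (add_le_add hB hμD)))
  have hδ := ENNReal.tendsto_inv_nat_nhds_zero
  have hlim : Filter.Tendsto (fun n : ℕ => (n : ℝ≥0∞)⁻¹ * (n : ℝ≥0∞)⁻¹ +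
      (C * (∫⁻ u, L u ∂μ.fst + (n : ℝ≥0∞)⁻¹) + (n : ℝ≥0∞)⁻¹))
      Filter.atTop (𝓝 (0 * 0 + (C * (∫⁻ u, L u ∂μ.fst + 0) + 0))) :=
    (ENNReal.Tendsto.mul hδ (.inr ENNReal.zero_ne_top) hδ (.inr ENNReal.zero_ne_top)).add
      ((ENNReal.Tendsto.const_mul (tendsto_const_nhds.add hδ) (.inr hCtop)).add hδ)
  simp only [mul_zero, add_zero, zero_add] at hlim
  refine ge_of_tendsto hlim (Filter.eventually_atTop.2 ⟨1, fun n hn => key _ ?_ ?_⟩)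
  · simp
  · simp; omega

end

/-! ### The two risk bounds -/

theorem mainTheorem6 {𝓦 𝓧 𝓦' 𝓤 : Type*} [MeasurableSpace 𝓦] [MeasurableSpace 𝓧]
    [MeasurableSpace 𝓦'] [MeasurableSpace 𝓤]
    (π : Measure 𝓦) [IsProbabilityMeasure π] (P : Kernel 𝓦 𝓧) [IsMarkovKernel P]
    (ℓ : 𝓦 → 𝓦' → ℝ≥0) (hℓ : Measurable (Function.uncurry ℓ))
    (κ : Kernel (𝓦 × 𝓧) 𝓤) [IsMarkovKernel κ]
    (η : Kernel 𝓤 𝓦) [IsMarkovKernel η] (hη : IsCondLawOfParam (jointLaw π P κ) η)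
    (ρ : ℝ) (hρ : 0 < ρ)
    (hL : AEMeasurable (condSmallBall η ℓ ρ) (jointLaw π P κ).fst) :
    (∀ α : ℝ, 1 ≤ α →
      (condSibson α (jointLaw π P κ) η ≠ ⊤ ∨
        ∫⁻ u, condSmallBall η ℓ ρ u ∂(jointLaw π P κ).fst ≠ 0) →
      (ρ : EReal) * (1 - (EReal.exp ((((α - 1) / α : ℝ) : EReal) *
          (condSibson α (jointLaw π P κ) η +
            ENNReal.log (∫⁻ u, condSmallBall η ℓ ρ u ∂(jointLaw π P κ).fst))) : EReal))
        ≤ (bayesianRisk π P ℓ : EReal)) ∧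
    ((condMaxLeakage (jointLaw π P κ) ≠ ⊤ ∨
        ∫⁻ u, condSmallBall η ℓ ρ u ∂(jointLaw π P κ).fst ≠ 0) →
      (ρ : EReal) * (1 - (EReal.exp (condMaxLeakage (jointLaw π P κ) +
            ENNReal.log (∫⁻ u, condSmallBall η ℓ ρ u ∂(jointLaw π P κ).fst)) : EReal))
        ≤ (bayesianRisk π P ℓ : EReal)) := by
  have hS : ∀ φ : 𝓧 → 𝓦', Measurable φ →
      MeasurableSet {p : 𝓦 × 𝓧 | (ℓ p.1 (φ p.2) : ℝ) < ρ} := fun φ hφ =>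
    measurableSet_lt (measurable_coe_nnreal_real.comp
      (hℓ.comp (measurable_fst.prodMk (hφ.comp measurable_snd)))) measurable_const
  refine ⟨fun α hα h => coe_mul_one_sub_le_bayesianRisk π P hℓ hρ fun φ hφ => ?_,
    fun h => coe_mul_one_sub_le_bayesianRisk π P hℓ hρ fun φ hφ => ?_⟩
  · rcases hα.eq_or_lt with rfl | hα
    -- At `α = 1` the factor `(α - 1)/α` vanishes, the exponential is `1`, and the bound is trivial.
    · simpa using prob_le_one
    · rw [← jointLaw_snd_preimage π P κ (hS φ hφ)]
      exact measure_smallBall_le_exp_condSibson _ η (hS φ hφ) hα h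
  · rcases eq_or_ne (condMaxLeakage (jointLaw π P κ)) ⊤ with htop | htop
    · have h0 := h.resolve_left (not_not.2 htop)
      rw [htop, EReal.top_add_of_ne_bot (by simpa using h0), EReal.exp_top]
      exact le_top
    -- The small-ball function is replaced by a measurable version, which still dominates the
    -- sections for almost every `u`.
    · rw [← jointLaw_snd_preimage π P κ (hS φ hφ), EReal.exp_add,
        ENNReal.exp_log, lintegral_congr_ae hL.ae_eq_mk]
      refine measure_snd_preimage_le_exp_condMaxLeakage hη htop (hS φ hφ) hL.measurable_mk ?_
      filter_upwards [hL.ae_eq_mk] with u hu x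
      rw [← hu]
      exact le_iSup (fun w' => η u {w | (ℓ w w' : ℝ) < ρ}) (φ x)
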